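/- Let $k$ be a positive integer that is sixth-power free, i.e. not divisible by $d^6$ for any integer $d>1$, and let $C_k$ be the plane projective curve $x^6+y^6=kz^6$ over $\mathbb{Q}$. Call $C_k$ locally solvable if $C_k(\mathbb{R})\neq\emptyset$ and $C_k(\mathbb{Q}_p)\neq\emptyset$ for every prime $p$. Then $C_k$ is locally solvable if and only if both of the following conditions hold: (1) $C_k(\mathbb{Q}_p)\neq\emptyset$ for every prime $p<400$; (2) every odd prime $p$ dividing $k$ satisfies $p\equiv 1 \pmod 4$. -/

import Mathlib

open scoped LinearAlgebra.Projectivization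

/-- The set `C_k(K)` of `K`-rational points of the plane projective curve
`C_k : x ^ 6 + y ^ 6 = k z ^ 6`. The equation is homogeneous, so it may be tested on any
representative of the point (see `mk_mem_sexticPoints`). -/
def sexticPoints (k : ℕ) (K : Type*) [Field K] : Set (ℙ K (Fin 3 → K)) :=
  {P | P.rep 0 ^ 6 + P.rep 1 ^ 6 = (k : K) * P.rep 2 ^ 6}

theorem mk_mem_sexticPoints (k : ℕ) {K : Type*} [Field K] (v : Fin 3 → K) (hv : v ≠ 0) :
    Projectivization.mk K v hv ∈ sexticPoints k K ↔
      v 0 ^ 6 + v 1 ^ 6 = (k : K) * v 2 ^ 6 := by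
  obtain ⟨a, ha⟩ := Projectivization.exists_smul_eq_mk_rep K v hv
  have h6 : (a : K) ^ 6 ≠ 0 := pow_ne_zero 6 a.ne_zero
  simp only [sexticPoints, Set.mem_ofPred_eq, ← ha, Units.smul_def, Pi.smul_apply, smul_eq_mul,
    mul_pow]
  rw [← mul_add, mul_left_comm, mul_right_inj' h6]

/-- `C_k` has a real point and a `p`-adic point for every prime `p`. -/
def SexticLocallySolvable (k : ℕ) : Prop :=
  (sexticPoints k ℝ).Nonempty ∧
    ∀ (p : ℕ) [Fact p.Prime], (sexticPoints k ℚ_[p]).Nonempty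

/-- `k` is not divisible by the sixth power of an integer greater than one. -/
def SixthPowerFree (k : ℕ) : Prop :=
  ∀ d : ℕ, d ^ 6 ∣ k → d = 1

/-! A real point always exists. If p ≡ 1 mod 4, a square root i of -1 mod p gives i^6 = -1, which
Hensel lifts to a point at infinity. If p ≡ 3 mod 4, p ≥ 400 and p ∤ k, it suffices to write k as a
sum of two sixth powers mod p. When p ≡ 2 mod 3, cubing is onto and two squares suffice. When p ≡ 1
mod 3, expanding in Jacobi sums of a character of order 6 gives a main term p - 2 against an error
of at most 15 + 20√p.

Conversely, let an odd p divide k. The valuation of k is not a multiple of 6, so x^6 + y^6 never has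
the norm of a nonzero sixth power. Hence x and y have equal norm and x^6 + y^6 cancels mod p, which
makes -1 a square. -/

/-! ### Jacobi sums and sums of two sixth powers in finite fields -/

section CharacterSums

variable {F : Type*} [Field F] [Fintype F]

/-- A Jacobi sum with parameter `c` in place of `1`. -/
theorem sum_mulChar_mul_mulChar_sub {R : Type*} [CommRing R] (χ ψ : MulChar F R) {c : F}
    (hc : c ≠ 0) : ∑ a, χ a * ψ (c - a) = χ c * ψ c * jacobiSum χ ψ := by
  rw [jacobiSum, Finset.mul_sum, ← Equiv.sum_comp (Equiv.mulLeft₀ c hc)]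
  refine Finset.sum_congr rfl fun a _ ↦ ?_
  have h : c - c * a = c * (1 - a) := by ring
  simp only [Equiv.mulLeft₀_apply, h, map_mul]
  ring

theorem norm_mulChar_apply_le_one (χ : MulChar F ℂ) (a : F) : ‖χ a‖ ≤ 1 := by
  classical
  by_cases ha : IsUnit a
  · obtain ⟨u, rfl⟩ := ha
    exact (Complex.norm_eq_one_of_mem_rootsOfUnity (χ.apply_mem_rootsOfUnity u)).le
  · simp [χ.map_nonunit ha]

theorem norm_jacobiSum_sq {χ ψ : MulChar F ℂ} (hχ : χ ≠ 1) (hψ : ψ ≠ 1) (hχψ : χ * ψ ≠ 1) :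
    ‖jacobiSum χ ψ‖ ^ 2 = Fintype.card F := by
  have hchar : ringChar ℂ ≠ ringChar F := by
    rw [ringChar.eq_zero]
    exact (CharP.ringChar_ne_zero_of_finite F).symm
  have hconj : jacobiSum χ⁻¹ ψ⁻¹ = star (jacobiSum χ ψ) := by
    simp only [jacobiSum, star_sum, star_mul', MulChar.star_apply']
  have h := jacobiSum_mul_jacobiSum_inv hchar hχ hψ hχψ
  rw [hconj, Complex.star_def, Complex.mul_conj, Complex.normSq_eq_norm_sq] at h
  exact_mod_cast h

theorem norm_jacobiSum_one_nontrivial {χ : MulChar F ℂ} (hχ : χ ≠ 1) :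
    ‖jacobiSum 1 χ‖ ≤ 1 := by
  rw [jacobiSum_one_nontrivial hχ]
  simp

theorem norm_jacobiSum_of_mul_eq_one {χ ψ : MulChar F ℂ} (hχ : χ ≠ 1) (h : χ * ψ = 1) :
    ‖jacobiSum χ ψ‖ ≤ 1 := by
  rw [← inv_eq_of_mul_eq_one_right h, jacobiSum_nontrivial_inv hχ, norm_neg]
  exact norm_mulChar_apply_le_one χ _

/-- An element of a finite field on which a character of order `n` takes the value `1` is an
`n`-th power. -/
theorem exists_pow_eq_of_mulChar_apply_eq_one {R : Type*} [CommRing R] [IsDomain R]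
    (χ : MulChar F R) {a : F} (ha : χ a = 1) : ∃ x : F, x ^ orderOf χ = a := by
  classical
  obtain ⟨g, hg⟩ := IsCyclic.exists_generator (α := Fˣ)
  have ha0 : a ≠ 0 := by
    rintro rfl
    rw [MulChar.map_zero] at ha
    exact zero_ne_one ha
  obtain ⟨m, hm⟩ := mem_powers_iff_mem_zpowers.mpr (hg (Units.mk0 a ha0))
  have hm' : (g : F) ^ m = a := by simpa using congrArg Units.val hm
  have hχm : χ ^ m = 1 := by
    rw [MulChar.eq_iff hg, MulChar.pow_apply_coe, MulChar.one_apply_coe, ← map_pow, hm', ha]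
  obtain ⟨l, hl⟩ := orderOf_dvd_of_pow_eq_one hχm
  exact ⟨(g : F) ^ l, by rw [← pow_mul, mul_comm, ← hl, hm']⟩

/-- Geometric series in χ a, a root of unity other than 1 unless a = 0. The sum thus detects nonzero
powers of exponent `orderOf χ`. -/
theorem sum_range_mulChar_pow_eq_zero {χ : MulChar F ℂ} {a : F}
    (ha : ∀ x ≠ 0, x ^ orderOf χ ≠ a) : ∑ i ∈ Finset.range (orderOf χ), (χ ^ i) a = 0 := by
  rcases eq_or_ne a 0 with rfl | ha0
  · exact Finset.sum_eq_zero fun i _ ↦ MulChar.map_zero _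
  have h1 : χ a ≠ 1 := by
    intro h
    obtain ⟨x, hx⟩ := exists_pow_eq_of_mulChar_apply_eq_one χ h
    refine ha x ?_ hx
    rintro rfl
    rw [zero_pow χ.orderOf_pos.ne'] at hx
    exact ha0 hx.symm
  have hpow (i : ℕ) : (χ ^ i) a = χ a ^ i := by
    exact MulChar.pow_apply_coe χ i (Units.mk0 a ha0)
  have hone : χ a ^ orderOf χ = 1 := by
    rw [← hpow, pow_orderOf_eq_one]
    exact MulChar.one_apply (isUnit_iff_ne_zero.mpr ha0)
  simp only [hpow]
  rw [geom_sum_eq h1, hone, sub_self, zero_div]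

/-- Bound for the Jacobi sums of powers of a character of order six. -/
theorem norm_jacobiSum_pow_le {χ : MulChar F ℂ} (hχ : orderOf χ = 6) {i j : ℕ} (hi : i < 6)
    (hj : j < 6) (hij : i ≠ 0 ∨ j ≠ 0) :
    ‖jacobiSum (χ ^ i) (χ ^ j)‖ ≤
      if i = 0 ∨ j = 0 ∨ i + j = 6 then 1 else √(Fintype.card F) := by
  have hne (m : ℕ) : χ ^ m ≠ 1 ↔ ¬ 6 ∣ m := by rw [Ne, ← orderOf_dvd_iff_pow_eq_one, hχ]
  split_ifs with h
  · rcases eq_or_ne i 0 with rfl | hi0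
    · rw [pow_zero]
      exact norm_jacobiSum_one_nontrivial ((hne j).mpr (by omega))
    rcases eq_or_ne j 0 with rfl | hj0
    · rw [pow_zero, jacobiSum_comm]
      exact norm_jacobiSum_one_nontrivial ((hne i).mpr (by omega))
    refine norm_jacobiSum_of_mul_eq_one ((hne i).mpr (by omega)) ?_
    rw [← pow_add, ← orderOf_dvd_iff_pow_eq_one, hχ]
    omega
  · refine Real.le_sqrt_of_sq_le (norm_jacobiSum_sq ((hne i).mpr (by omega))
      ((hne j).mpr (by omega)) ?_).le
    rw [← pow_add]
    exact (hne _).mpr (by omega)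

/-- If `q ≡ 1 [MOD 6]` and `q > 17 + 20 √q`, then every nonzero element of the field with `q`
elements is a sum of two nonzero sixth powers. -/
theorem exists_pow_six_add_pow_six_of_card (h6 : 6 ∣ Fintype.card F - 1)
    (hcard : 17 + 20 * √(Fintype.card F) < Fintype.card F) {c : F} (hc : c ≠ 0) :
    ∃ x y : F, x ≠ 0 ∧ y ≠ 0 ∧ x ^ 6 + y ^ 6 = c := by
  classical
  by_contra! hno
  obtain ⟨χ, hχ⟩ := MulChar.exists_mulChar_orderOf F h6 (Complex.isPrimitiveRoot_exp 6 (by norm_num))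
  -- A nonzero product would make both a and c - a nonzero sixth powers.
  have hzero (a : F) : (∑ i ∈ Finset.range 6, (χ ^ i) a) *
      ∑ j ∈ Finset.range 6, (χ ^ j) (c - a) = 0 := by
    by_cases ha : ∃ x : F, x ≠ 0 ∧ x ^ 6 = a
    · obtain ⟨x, hx, rfl⟩ := ha
      rw [← hχ, sum_range_mulChar_pow_eq_zero (a := c - x ^ orderOf χ), mul_zero]
      intro y hy h
      rw [hχ] at h
      exact hno x y hx hy (by rw [h]; ring)
    · rw [← hχ, sum_range_mulChar_pow_eq_zero, zero_mul]
      intro x hx h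
      exact ha ⟨x, hx, hχ ▸ h⟩
  set T : ℕ → ℕ → ℂ := fun i j ↦ (χ ^ i) c * (χ ^ j) c * jacobiSum (χ ^ i) (χ ^ j) with hT
  have hsum : ∑ i ∈ Finset.range 6, ∑ j ∈ Finset.range 6, T i j = 0 := by
    calc _ = ∑ i ∈ Finset.range 6, ∑ j ∈ Finset.range 6, ∑ a, (χ ^ i) a * (χ ^ j) (c - a) := by
          simp only [hT, sum_mulChar_mul_mulChar_sub _ _ hc]
      _ = ∑ a, (∑ i ∈ Finset.range 6, (χ ^ i) a) * ∑ j ∈ Finset.range 6, (χ ^ j) (c - a) := by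
          simp only [Finset.sum_mul_sum]
          symm
          rw [Finset.sum_comm]
          exact Finset.sum_congr rfl fun i _ ↦ Finset.sum_comm
      _ = 0 := Finset.sum_eq_zero fun a _ ↦ hzero a
  have h00 : T 0 0 = Fintype.card F - 2 := by
    simp [hT, jacobiSum_one_one, MulChar.one_apply (isUnit_iff_ne_zero.mpr hc)]
  have hbound (i j : ℕ) (hi : i < 6) (hj : j < 6) (hij : i ≠ 0 ∨ j ≠ 0) :
      ‖T i j‖ ≤ if i = 0 ∨ j = 0 ∨ i + j = 6 then 1 else √(Fintype.card F) := by
    refine le_trans ?_ (norm_jacobiSum_pow_le hχ hi hj hij)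
    simp only [hT, norm_mul]
    refine mul_le_of_le_one_left (norm_nonneg _) ?_
    exact mul_le_one₀ (norm_mulChar_apply_le_one _ _) (norm_nonneg _)
      (norm_mulChar_apply_le_one _ _)
  let S := (Finset.range 6 ×ˢ Finset.range 6).erase (0, 0)
  have hsplit : T 0 0 = -∑ q ∈ S, T q.1 q.2 := by
    rw [← Finset.sum_product', ← Finset.add_sum_erase _ _ (a := (0, 0)) (by simp)] at hsum
    exact eq_neg_of_add_eq_zero_left hsum
  have hle : ‖T 0 0‖ ≤ 15 + 20 * √(Fintype.card F) := by
    rw [hsplit, norm_neg]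
    calc _ ≤ ∑ q ∈ S, if q.1 = 0 ∨ q.2 = 0 ∨ q.1 + q.2 = 6 then 1 else √(Fintype.card F) := by
          refine norm_sum_le_of_le _ fun q hq ↦ ?_
          obtain ⟨hq0, hq⟩ := Finset.mem_erase.mp hq
          rw [Finset.mem_product, Finset.mem_range, Finset.mem_range] at hq
          refine hbound q.1 q.2 hq.1 hq.2 ?_
          by_contra! h
          exact hq0 (Prod.ext h.1 h.2)
      _ = 15 + 20 * √(Fintype.card F) := by
          rw [Finset.sum_ite, Finset.sum_const, Finset.sum_const]
          -- Ten pairs have exactly one zero entry and five have i + j = 6; the other 20 of the 35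
          -- pairs cost √q each.
          have h1 : (S.filter fun q ↦ q.1 = 0 ∨ q.2 = 0 ∨ q.1 + q.2 = 6).card = 15 := by decide
          have h2 : (S.filter fun q ↦ ¬(q.1 = 0 ∨ q.2 = 0 ∨ q.1 + q.2 = 6)).card = 20 := by decide
          rw [h1, h2]
          simp
  have hge : (Fintype.card F : ℝ) - 2 ≤ ‖T 0 0‖ := by
    refine le_trans (le_of_eq ?_) (Complex.re_le_norm _)
    rw [h00]
    simp
  linarith

end CharacterSums

/-! ### Sums of two sixth powers modulo p -/

section ZModSixthPowers

variable {p : ℕ} [Fact p.Prime]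

theorem ZMod.exists_pow_three_eq (hp : p % 3 = 2) (u : ZMod p) : ∃ x : ZMod p, x ^ 3 = u := by
  obtain ⟨m, rfl⟩ : ∃ m, p = 3 * m + 2 := ⟨p / 3, by omega⟩
  -- 3(2m + 1) = 2(p - 1) + 1, so this exponent inverts cubing.
  refine ⟨u ^ (2 * m + 1), ?_⟩
  have h := ZMod.pow_card u
  calc (u ^ (2 * m + 1)) ^ 3 = u ^ (3 * m + 2) * u ^ (3 * m + 1) := by ring
    _ = u ^ (3 * m + 2) := by
      rw [h, ← pow_succ', h]
    _ = u := h

theorem ZMod.exists_pow_six_add_pow_six_of_mod_three_eq_two (hp : p % 3 = 2) (c : ZMod p) :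
    ∃ x y : ZMod p, x ^ 6 + y ^ 6 = c := by
  obtain ⟨u, v, h⟩ := ZMod.sq_add_sq p c
  obtain ⟨x, rfl⟩ := ZMod.exists_pow_three_eq hp u
  obtain ⟨y, rfl⟩ := ZMod.exists_pow_three_eq hp v
  exact ⟨x, y, by rw [← h]; ring⟩

theorem ZMod.exists_pow_six_add_pow_six (hp : p % 4 = 3) (hp400 : 400 ≤ p) {c : ZMod p}
    (hc : c ≠ 0) : ∃ x y : ZMod p, x ^ 6 + y ^ 6 = c := by
  have hprime : p.Prime := Fact.out
  have h3 : p % 3 ≠ 0 := fun h ↦ by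
    have := (Nat.prime_dvd_prime_iff_eq Nat.prime_three hprime).mp (Nat.dvd_of_mod_eq_zero h)
    omega
  rcases (by omega : p % 3 = 2 ∨ p % 3 = 1) with h | h
  · exact ZMod.exists_pow_six_add_pow_six_of_mod_three_eq_two h c
  -- The inequality p > 17 + 20√p still fails at 433, but the integers ≡ 7 mod 12 from 400 to 434
  -- are all composite.
  have hp435 : 435 ≤ p := by
    by_contra! hlt
    obtain rfl | rfl | rfl : p = 403 ∨ p = 415 ∨ p = 427 := by omega
    all_goals norm_num at hprime
  obtain ⟨x, y, -, -, hxy⟩ := exists_pow_six_add_pow_six_of_card (F := ZMod p)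
    (by rw [ZMod.card]; omega) (by
      rw [ZMod.card]
      have h' : (435 : ℝ) ≤ p := by exact_mod_cast hp435
      have : √(p : ℝ) < ((p : ℝ) - 17) / 20 := by
        rw [Real.sqrt_lt' (by linarith)]
        nlinarith
      linarith) hc
  exact ⟨x, y, hxy⟩

end ZModSixthPowers

/-! ### Hensel lifting and the obstruction at primes dividing k -/

section Padic

variable {p : ℕ} [Fact p.Prime]

theorem PadicInt.toZMod_eq_zero_iff_norm_lt_one (x : ℤ_[p]) : toZMod x = 0 ↔ ‖x‖ < 1 := by
  rw [← RingHom.mem_ker, ker_toZMod, IsLocalRing.mem_maximalIdeal, mem_nonunits]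

theorem PadicInt.exists_toZMod_eq (a : ZMod p) : ∃ x : ℤ_[p], toZMod x = a :=
  ⟨(a.val : ℤ_[p]), by simp⟩

/-- Hensel lifting of `n`-th roots of units, for `n` prime to `p`. -/
theorem PadicInt.exists_pow_eq_of_toZMod {n : ℕ} (hn : ¬ p ∣ n) {c : ℤ_[p]} {a : ZMod p}
    (ha : a ≠ 0) (h : a ^ n = toZMod c) : ∃ z : ℤ_[p], z ^ n = c := by
  obtain ⟨b, rfl⟩ := exists_toZMod_eq a
  let f : Polynomial ℤ_[p] := Polynomial.X ^ n - Polynomial.C c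
  have hf : ‖f.aeval b‖ < 1 := by
    rw [← toZMod_eq_zero_iff_norm_lt_one]
    simp [f, h]
  have hf' : ‖f.derivative.aeval b‖ = 1 := by
    refine le_antisymm (norm_le_one _) (not_lt.mp ?_)
    rw [← toZMod_eq_zero_iff_norm_lt_one]
    simp [f, Polynomial.derivative_X_pow, ha, ZMod.natCast_eq_zero_iff, hn]
  obtain ⟨z, hz, -⟩ := hensels_lemma (F := f) (a := b) (by rwa [hf', one_pow])
  exact ⟨z, sub_eq_zero.mp (by simpa [f] using hz)⟩

theorem sexticPoints_nonempty_iff (k : ℕ) (K : Type*) [Field K] :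
    (sexticPoints k K).Nonempty ↔
      ∃ x y z : K, (x ≠ 0 ∨ y ≠ 0 ∨ z ≠ 0) ∧ x ^ 6 + y ^ 6 = k * z ^ 6 := by
  constructor
  · rintro ⟨P, hP⟩
    refine ⟨P.rep 0, P.rep 1, P.rep 2, ?_, hP⟩
    by_contra! h
    exact P.rep_nonzero (funext fun i ↦ by fin_cases i <;> simp [h])
  · rintro ⟨x, y, z, h0, h⟩
    have hv : ![x, y, z] ≠ 0 := fun hv ↦ by
      have h₀ := congrFun hv 0
      have h₁ := congrFun hv 1
      have h₂ := congrFun hv 2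
      simp at h₀ h₁ h₂
      tauto
    exact ⟨Projectivization.mk K _ hv, (mk_mem_sexticPoints k _ hv).mpr (by simpa using h)⟩

theorem not_dvd_six_of_five_le (hp : 5 ≤ p) : ¬ p ∣ 6 := by
  intro h
  have hprime : p.Prime := Fact.out
  have := Nat.le_of_dvd (by norm_num) h
  interval_cases p <;> revert h hprime <;> norm_num

/-- If `p ≡ 1 [MOD 4]`, then the curve has a point at infinity over `ℚ_[p]`. -/
theorem sexticPoints_padic_nonempty_of_mod_four_eq_one (k : ℕ) (hp : p % 4 = 1) :
    (sexticPoints k ℚ_[p]).Nonempty := by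
  have hprime : p.Prime := Fact.out
  have hp5 : 5 ≤ p := by
    have := hprime.two_le
    omega
  obtain ⟨i, hi⟩ := ZMod.exists_sq_eq_neg_one_iff.mpr (show p % 4 ≠ 3 by omega)
  have hi0 : i ≠ 0 := by
    rintro rfl
    simp at hi
  obtain ⟨z, hz⟩ := PadicInt.exists_pow_eq_of_toZMod (not_dvd_six_of_five_le hp5) (c := -1) hi0
    (by rw [map_neg, map_one, show i ^ 6 = (i * i) ^ 3 by ring, ← hi]; ring)
  refine (sexticPoints_nonempty_iff k _).mpr ⟨z, 1, 0, by simp, ?_⟩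
  have hz' : (z : ℚ_[p]) ^ 6 = -1 := by exact_mod_cast congrArg ((↑) : ℤ_[p] → ℚ_[p]) hz
  rw [hz']
  simp

/-- A smooth affine point modulo `p` lifts to `ℚ_[p]`. -/
theorem sexticPoints_padic_nonempty_of_zmod {k : ℕ} (hp : ¬ p ∣ 6) (hk : ¬ p ∣ k) {x y : ZMod p}
    (h : x ^ 6 + y ^ 6 = k) : (sexticPoints k ℚ_[p]).Nonempty := by
  -- Hensel needs a nonzero coordinate to solve for; k ≠ 0 mod p provides one.
  wlog hx : x ≠ 0 generalizing x y
  · refine this (x := y) (y := x) (by rw [add_comm, h]) ?_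
    rintro rfl
    rw [not_not.mp hx] at h
    exact hk ((ZMod.natCast_eq_zero_iff k p).mp (by simpa using h.symm))
  obtain ⟨b, rfl⟩ := PadicInt.exists_toZMod_eq y
  obtain ⟨z, hz⟩ := PadicInt.exists_pow_eq_of_toZMod hp (c := (k : ℤ_[p]) - b ^ 6) hx
    (by rw [map_sub, map_pow, map_natCast, ← h]; ring)
  refine (sexticPoints_nonempty_iff k _).mpr ⟨z, b, 1, by simp, ?_⟩
  have hz' : (z : ℚ_[p]) ^ 6 = k - (b : ℚ_[p]) ^ 6 := by
    exact_mod_cast congrArg ((↑) : ℤ_[p] → ℚ_[p]) hz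
  rw [hz']
  ring

theorem sexticPoints_padic_nonempty_of_large {k : ℕ} (hp : 400 ≤ p)
    (hk : p ∣ k → p ≡ 1 [MOD 4]) : (sexticPoints k ℚ_[p]).Nonempty := by
  have hodd : p % 2 = 1 := (Fact.out : p.Prime).eq_two_or_odd.resolve_left (by omega)
  rcases (by omega : p % 4 = 1 ∨ p % 4 = 3) with h1 | h3
  · exact sexticPoints_padic_nonempty_of_mod_four_eq_one k h1
  have hpk : ¬ p ∣ k := fun h ↦ by
    have := hk h
    unfold Nat.ModEq at this
    omega
  obtain ⟨x, y, hxy⟩ := ZMod.exists_pow_six_add_pow_six h3 hp (c := (k : ZMod p))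
    (by rwa [Ne, ZMod.natCast_eq_zero_iff])
  exact sexticPoints_padic_nonempty_of_zmod (not_dvd_six_of_five_le (by omega)) hpk hxy

/-- The `p`-adic norm of a sixth-power-free multiple of `p` is not the norm of a sixth power. -/
theorem SixthPowerFree.padicNorm_ne_pow_six {k : ℕ} (hk : 0 < k) (hfree : SixthPowerFree k)
    (hpk : p ∣ k) (w : ℚ_[p]) : ‖(k : ℚ_[p])‖ ≠ ‖w‖ ^ 6 := by
  have hprime : p.Prime := Fact.out
  intro h
  have hk0 : (k : ℚ_[p]) ≠ 0 := by exact_mod_cast hk.ne'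
  have hw : w ≠ 0 := by
    rintro rfl
    simp at h
    omega
  have hp1 : (1 : ℝ) < p := by exact_mod_cast hprime.one_lt
  rw [Padic.norm_eq_zpow_neg_valuation hk0, Padic.norm_eq_zpow_neg_valuation hw,
    ← zpow_natCast, ← zpow_mul] at h
  have h' := zpow_right_injective₀ (by linarith) hp1.ne' h
  simp only [Padic.valuation_natCast] at h'
  have hpos : 1 ≤ padicValNat p k := one_le_padicValNat_of_dvd hk.ne' hpk
  have h6 : p ^ 6 ∣ k := (pow_dvd_pow p (by omega)).trans pow_padicValNat_dvd
  exact hprime.one_lt.ne' (hfree p h6)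

theorem modEq_one_of_sexticPoints_padic_nonempty {k : ℕ} (hk : 0 < k) (hfree : SixthPowerFree k)
    (hodd : Odd p) (hpk : p ∣ k) (hne : (sexticPoints k ℚ_[p]).Nonempty) : p ≡ 1 [MOD 4] := by
  obtain ⟨x, y, z, h0, h⟩ := (sexticPoints_nonempty_iff k _).mp hne
  have hk0 : (k : ℚ_[p]) ≠ 0 := by exact_mod_cast hk.ne'
  -- Otherwise k would have the norm of (w / z)^6.
  have hnot (w : ℚ_[p]) (hw : w ≠ 0) : ‖x ^ 6 + y ^ 6‖ ≠ ‖w‖ ^ 6 := by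
    intro hn
    rw [h, norm_mul, norm_pow] at hn
    have hz : ‖z‖ ≠ 0 := by
      intro hz
      rw [hz, zero_pow (by norm_num), mul_zero] at hn
      exact hw (norm_eq_zero.mp (pow_eq_zero_iff (by norm_num) |>.mp hn.symm))
    refine hfree.padicNorm_ne_pow_six hk hpk (w / z) ?_
    rw [norm_div, div_pow, ← hn]
    field_simp
  -- With unequal norms, the ultrametric inequality would give the sum the norm of the larger sixth
  -- power.
  have hxy : ‖x‖ = ‖y‖ := by
    by_contra hxy
    have hpow : ‖x ^ 6‖ ≠ ‖y ^ 6‖ := by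
      rw [norm_pow, norm_pow]
      exact fun h ↦ hxy ((pow_left_inj₀ (norm_nonneg _) (norm_nonneg _) (by norm_num)).mp h)
    have hmax := Padic.add_eq_max_of_ne hpow
    rcases max_choice ‖x ^ 6‖ ‖y ^ 6‖ with hm | hm
    · refine hnot x ?_ (by rw [hmax, hm, norm_pow])
      rintro rfl
      have := le_max_right ‖(0 : ℚ_[p]) ^ 6‖ ‖y ^ 6‖
      rw [hm] at this
      exact hpow (le_antisymm (by simp) this)
    · refine hnot y ?_ (by rw [hmax, hm, norm_pow])
      rintro rfl
      have := le_max_left ‖x ^ 6‖ ‖(0 : ℚ_[p]) ^ 6‖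
      rw [hm] at this
      exact hpow (le_antisymm this (by simp))
  have hy : y ≠ 0 := by
    rintro rfl
    have hx : x = 0 := by simpa using hxy
    subst hx
    have : z = 0 := by simpa [hk0] using h.symm
    simp [this] at h0
  have hny : ‖y‖ ≠ 0 := norm_ne_zero_iff.mpr hy
  have ht : ‖x / y‖ ≤ 1 := by rw [norm_div, hxy, div_self hny]
  let t : ℤ_[p] := ⟨x / y, ht⟩
  -- Norm 1 here would give x^6 + y^6 the norm of y^6.
  have hle : ‖t ^ 6 + 1‖ < 1 := by
    refine lt_of_le_of_ne (PadicInt.norm_le_one _) fun h1 ↦ hnot y hy ?_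
    have : x ^ 6 + y ^ 6 = ((t ^ 6 + 1 : ℤ_[p]) : ℚ_[p]) * y ^ 6 := by
      have htc : (t : ℚ_[p]) = x / y := rfl
      rw [PadicInt.coe_add, PadicInt.coe_pow, PadicInt.coe_one, htc]
      field_simp
    rw [this, norm_mul, norm_pow, ← PadicInt.norm_def, h1, one_mul]
  rw [← PadicInt.toZMod_eq_zero_iff_norm_lt_one, map_add, map_pow, map_one] at hle
  have hsq : IsSquare (-1 : ZMod p) :=
    ⟨PadicInt.toZMod t ^ 3, by linear_combination -hle⟩
  have := ZMod.exists_sq_eq_neg_one_iff.mp hsq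
  have := Nat.odd_iff.mp hodd
  unfold Nat.ModEq
  omega

end Padic

theorem sexticPoints_real_nonempty (k : ℕ) : (sexticPoints k ℝ).Nonempty := by
  refine (sexticPoints_nonempty_iff k _).mpr ⟨(k : ℝ) ^ ((6 : ℕ) : ℝ)⁻¹, 0, 1, by simp, ?_⟩
  rw [Real.rpow_inv_natCast_pow (Nat.cast_nonneg k) (by norm_num)]
  simp

theorem mainTheorem3 (k : ℕ) (hk : 0 < k) (hfree : SixthPowerFree k) :
    SexticLocallySolvable k ↔
      (∀ (p : ℕ) [Fact p.Prime], p < 400 → (sexticPoints k ℚ_[p]).Nonempty) ∧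
        ∀ p : ℕ, p.Prime → Odd p → p ∣ k → p ≡ 1 [MOD 4] := by
  constructor
  · rintro ⟨-, h⟩
    refine ⟨fun p _ _ ↦ h p, fun p hp hodd hpk ↦ ?_⟩
    have : Fact p.Prime := ⟨hp⟩
    exact modEq_one_of_sexticPoints_padic_nonempty hk hfree hodd hpk (h p)
  · rintro ⟨hsmall, hdvd⟩
    refine ⟨sexticPoints_real_nonempty k, fun p hp ↦ ?_⟩
    rcases lt_or_ge p 400 with h | h
    · exact hsmall p h
    · exact sexticPoints_padic_nonempty_of_large h
        (hdvd p hp.out (hp.out.odd_of_ne_two (by omega)))
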